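/- For an integer $x$ let $T_x = x(x+1)/2$; the integers of this form are called triangular numbers (so $0 = T_0$ is triangular). Squares are squares of integers (so $0$ is a square), and an odd square is the square of an odd integer. (i) Every positive integer is a sum of a square, an odd square and a triangular number; that is, for every integer $n \geq 1$ there are integers $x, y, z$ with $y$ odd and $n = x^2 + y^2 + T_z$. Moreover, for every integer $m \geq 1$, the triangular number $T_m$ is a sum of two odd squares and a triangular number if and only if $2m+1$ is not a prime congruent to $3$ modulo $4$. (ii) A positive integer $n$ cannot be written as a sum of an odd square and two triangular numbers if and only if $n = 2T_m$ for some integer $m \geq 1$ such that $2m+1$ has no prime divisor congruent to $3$ modulo $4$. -/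

import Mathlib

/-- The triangular number `T_x = x (x + 1) / 2` for an integer `x`. The division is exact,
since `x (x + 1)` is even. -/
def triangular (x : ℤ) : ℤ := x * (x + 1) / 2

/-- The integer division in the definition of `triangular` is exact. -/
theorem two_mul_triangular (x : ℤ) : 2 * triangular x = x * (x + 1) :=
  Int.mul_ediv_cancel' (Int.even_mul_succ_self x).two_dvd

/-!
Multiplying by `8` or `4` turns the representations in question into representations as sums of
three squares with parity conditions: `n = x² + y² + T_z` means `8 n + 1 = (2 z + 1)² + 8 (x² + y²)`,
and `n = x² + T_y + T_z` means `n = x² + t² + 2 T_j` for suitable `t` and `j`, because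
`T_{j+t} + T_{j-t} = 2 T_j + t²`. Existence without parity conditions comes from Legendre's theorem
on sums of three squares. It is proved for integers `≡ 1, 2 (mod 4)`: Dirichlet's theorem on primes
in arithmetic progressions and quadratic reciprocity give a positive ternary form of determinant
`1` that represents `n`, and `exists_sum_three_squares_of_ternary_det_one` reduces this form to
`x² + y² + z²`.

What remains is to get `x + y` odd in `k = x² + y² + T_z`; both parts rest on the dichotomy
`exists_odd_add_or_eq_triangular`. If `k` is not triangular, then Jacobi's identity
`∑ (-1)^(x+y) q^(x² + y² + T_z) = ∏ (1 - q^i)³ = ∑ (-1)^m (2 m + 1) q^(T_m)`, where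
`x` and `y` run over all integers and `z`, `m` over the nonnegative ones, says that
representations with `x + y` even and with `x + y` odd are equinumerous. This is obtained without
power series: up to a factor `4`, the number of representations of `k - T_z` as a sum of two squares
is `∑ χ₄(d)` over the divisors `d` of `k - T_z`, and the signed sum of `χ₄(d)` over the solutions of
`T_z + d δ = k` vanishes by a sign-reversing involution (`triangularProductInvolution`), which
preserves the set of solutions because `k` is not triangular. Only the sign of the divisor sum is
needed, namely that at positive integers it is positive on sums of two squares and zero otherwise.

If `k = T_m`, the question concerns `N² = w² + 8 (x² + y²)` with `N = 2 m + 1`. Solutions come from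
Euler's identity `(a² + b² + c² + d²)² = (a² + b² - c² - d²)² + 4 (b c + a d)² + 4 (b d - a c)²`
applied to a divisor of `N`, and the parities are controlled by the choice of the four squares
(`exists_sq_eq_of_one_mod_four`, `exists_sq_eq_of_three_mod_four`). Conversely, if no prime
`≡ 3 (mod 4)` divides both `(N - w) / 2` and `(N + w) / 2`, these factors of a sum of two squares
are themselves sums of two squares, and their sum `N` would have the wrong residue modulo `4`
(`not_sq_eq_of_prime`, `not_sq_eq_of_forall_prime`).
-/

/-! ### Reduction of positive definite forms and sums of three squares -/

theorem exists_two_mul_abs_sub_mul_le (a t : ℤ) (ha : 0 < a) :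
    ∃ k : ℤ, 2 * (t - k * a) ≤ a ∧ -a ≤ 2 * (t - k * a) := by
  refine ⟨(2 * t + a) / (2 * a), ?_⟩
  have h1 := Int.emod_add_mul_ediv (2 * t + a) (2 * a)
  have h2 := Int.emod_nonneg (2 * t + a) (b := 2 * a) (by omega)
  have h3 := Int.emod_lt_of_pos (2 * t + a) (b := 2 * a) (by omega)
  constructor <;> nlinarith

/-- Gauss reduction: a positive binary form `A y² + 2 B y z + C z²` of determinant `D` is
carried by a unimodular substitution to a form whose leading coefficient `A'` satisfies
`3 A'² ≤ 4 D`. -/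
theorem exists_unimodular_binary_reduction (k : ℕ) : ∀ A B C D : ℤ, 0 < A → A ≤ k →
    A * C - B ^ 2 = D → 0 < D →
    ∃ p q p' q' : ℤ, p * q' - q * p' = 1 ∧ 0 < A * p ^ 2 + 2 * B * p * p' + C * p' ^ 2 ∧
      3 * (A * p ^ 2 + 2 * B * p * p' + C * p' ^ 2) ^ 2 ≤ 4 * D := by
  induction k with
  | zero => intro A B C D h1 h2; omega
  | succ k ih =>
    intro A B C D hA hk hD hD0
    by_cases hred : 3 * A ^ 2 ≤ 4 * D
    · exact ⟨1, 0, 0, 1, by ring, by linarith, by nlinarith⟩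
    obtain ⟨j, hj1, hj2⟩ := exists_two_mul_abs_sub_mul_le A B hA
    set B' := B - j * A with hB'
    set C' := C - 2 * j * B + j ^ 2 * A with hC'
    have hD' : A * C' - B' ^ 2 = D := by rw [← hD, hB', hC']; ring
    have hB2 : 4 * B' ^ 2 ≤ A ^ 2 := by nlinarith
    have hlt : C' < A := by
      by_contra hge
      push Not at hge
      nlinarith
    have hC0 : 0 < C' := by
      by_contra hle
      push Not at hle
      nlinarith [sq_nonneg B']
    obtain ⟨p, q, p', q', h1, h2, h3⟩ := ih C' (-B') A D hC0 (by push_cast at hk; omega)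
      (by rw [← hD']; ring) hD0
    -- The substitution `y ↦ y - j z` followed by `(y, z) ↦ (-z, y)`.
    refine ⟨-p' - j * p, -q' - j * q, p, q, by linear_combination h1, ?_, ?_⟩
    · convert h2 using 1
      rw [hB', hC']; ring
    · convert h3 using 3
      rw [hB', hC']; ring

theorem exists_sq_add_sq_of_binary_det_one (A B C : ℤ) (hA : 0 < A) (hD : A * C - B ^ 2 = 1)
    (y z : ℤ) : ∃ u v : ℤ, A * y ^ 2 + 2 * B * y * z + C * z ^ 2 = u ^ 2 + v ^ 2 := by
  obtain ⟨p, q, p', q', h1, h2, h3⟩ :=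
    exists_unimodular_binary_reduction A.toNat A B C 1 hA (by omega) hD one_pos
  set A' := A * p ^ 2 + 2 * B * p * p' + C * p' ^ 2 with hA'
  have hA1 : A' = 1 := by nlinarith
  set B' := A * p * q + B * (p * q' + q * p') + C * p' * q' with hB'
  set C' := A * q ^ 2 + 2 * B * q * q' + C * q' ^ 2 with hC'
  have hD' : A' * C' - B' ^ 2 = 1 := by
    have : A' * C' - B' ^ 2 = (A * C - B ^ 2) * (p * q' - q * p') ^ 2 := by
      rw [hA', hB', hC']; ring
    rw [this, h1, hD]; norm_num
  have hval : A * y ^ 2 + 2 * B * y * z + C * z ^ 2 = A' * (q' * y - q * z) ^ 2 +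
      2 * B' * (q' * y - q * z) * (p * z - p' * y) + C' * (p * z - p' * y) ^ 2 := by
    have : A' * (q' * y - q * z) ^ 2 +
      2 * B' * (q' * y - q * z) * (p * z - p' * y) + C' * (p * z - p' * y) ^ 2
      = (A * y ^ 2 + 2 * B * y * z + C * z ^ 2) * (p * q' - q * p') ^ 2 := by
      rw [hA', hB', hC']; ring
    rw [this, h1]; ring
  refine ⟨(q' * y - q * z) + B' * (p * z - p' * y), p * z - p' * y, ?_⟩
  rw [hval, hA1]
  rw [hA1] at hD'
  linear_combination (p * z - p' * y) ^ 2 * hD'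

theorem pos_and_lt_of_reduced {a b t : ℤ} (ha : 1 < a) (ht : 4 * t ^ 2 ≤ a ^ 2)
    (h0 : 0 < a * b - t ^ 2) (h : 3 * (a * b - t ^ 2) ^ 2 ≤ 4 * a) : 0 < b ∧ b < a := by
  constructor
  · by_contra hle
    push Not at hle
    nlinarith [sq_nonneg t]
  · by_contra hge
    push Not at hge
    have h4 : 3 * a ^ 2 ≤ 4 * (a * b - t ^ 2) := by nlinarith
    have h5 : 3 * a ≤ 2 * (a * b - t ^ 2) := by nlinarith
    nlinarith

/-- A positive definite ternary form with integral Gram matrix of determinant `1` takes only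
values that are sums of three squares. The proof lowers the leading coefficient `a`: reducing the
binary form of determinant `a` in `a f = (a x + t y + s z)² + G(y, z)` makes the middle coefficient
smaller than `a` as long as `a > 1`. -/
theorem exists_sum_three_squares_of_ternary_det_one (k : ℕ) : ∀ a b c r s t : ℤ, 0 < a → a ≤ k →
    0 < a * b - t ^ 2 → a * b * c + 2 * r * s * t - a * r ^ 2 - b * s ^ 2 - c * t ^ 2 = 1 →
    ∀ x y z : ℤ, ∃ u v w : ℤ,
      a * x ^ 2 + b * y ^ 2 + c * z ^ 2 + 2 * r * y * z + 2 * s * x * z + 2 * t * x * y =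
        u ^ 2 + v ^ 2 + w ^ 2 := by
  induction k with
  | zero => intro a b c r s t h1 h2; omega
  | succ k ih =>
    intro a b c r s t ha hk hab hdet x y z
    have hbin : (a * b - t ^ 2) * (a * c - s ^ 2) - (a * r - s * t) ^ 2 = a := by
      linear_combination a * hdet
    rcases (show a = 1 ∨ 1 < a by omega) with rfl | ha1
    · obtain ⟨u, v, huv⟩ := exists_sq_add_sq_of_binary_det_one (b - t ^ 2) (r - s * t)
        (c - s ^ 2) (by linarith) (by linarith) y z
      exact ⟨x + t * y + s * z, u, v, by linear_combination huv⟩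
    obtain ⟨p, q, p', q', h1, h2, h3⟩ :=
      exists_unimodular_binary_reduction (a * b - t ^ 2).toNat _ _ _ _ hab (by omega) hbin ha
    set A := (a * b - t ^ 2) * p ^ 2 + 2 * (a * r - s * t) * p * p' + (a * c - s ^ 2) * p' ^ 2
      with hA
    obtain ⟨j, hj1, hj2⟩ := exists_two_mul_abs_sub_mul_le a (t * p + s * p') ha
    set b' := b * p ^ 2 + 2 * r * p * p' + c * p' ^ 2 with hb'
    set c' := b * q ^ 2 + 2 * r * q * q' + c * q' ^ 2 with hc'
    set r' := b * p * q + r * (p * q' + q * p') + c * p' * q' with hr'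
    set t' := t * p + s * p' with ht'
    set s' := t * q + s * q' with hs'
    set t₂ := t' - j * a with ht₂
    set b₂ := b' - 2 * j * t' + j ^ 2 * a with hb₂
    set r₂ := r' - j * s' with hr₂
    have hA₂ : a * b₂ - t₂ ^ 2 = A := by
      rw [hA, hb₂, ht₂, hb', ht']; ring
    have ht2 : 4 * t₂ ^ 2 ≤ a ^ 2 := by
      clear_value t₂
      clear * - hj1 hj2
      nlinarith
    obtain ⟨hb0, hlt⟩ := pos_and_lt_of_reduced ha1 ht2 (hA₂ ▸ h2) (hA₂ ▸ h3)
    have hdet₂ : b₂ * a * c' + 2 * s' * r₂ * t₂ - b₂ * s' ^ 2 - a * r₂ ^ 2 - c' * t₂ ^ 2 = 1 := by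
      have : b₂ * a * c' + 2 * s' * r₂ * t₂ - b₂ * s' ^ 2 - a * r₂ ^ 2 - c' * t₂ ^ 2 =
          (a * b * c + 2 * r * s * t - a * r ^ 2 - b * s ^ 2 - c * t ^ 2) *
            (p * q' - q * p') ^ 2 := by
        rw [hb₂, ht₂, hr₂, hb', hc', hr', ht', hs']; ring
      rw [this, h1, hdet]; norm_num
    obtain ⟨u, v, w, huvw⟩ := ih b₂ a c' s' r₂ t₂ hb0 (by push_cast at hk; omega)
      (by linarith) hdet₂ (q' * y - q * z) (x + j * (q' * y - q * z)) (p * z - p' * y)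
    refine ⟨u, v, w, ?_⟩
    rw [← huvw]
    have e1 : y = p * (q' * y - q * z) + q * (p * z - p' * y) := by linear_combination -y * h1
    have e2 : z = p' * (q' * y - q * z) + q' * (p * z - p' * y) := by linear_combination -z * h1
    generalize q' * y - q * z = Y at *
    generalize p * z - p' * y = Z at *
    rw [e1, e2, hb₂, ht₂, hr₂, hb', hc', hr', ht', hs']
    ring

/-- If `-d` is a square modulo `d n - 1`, then `n` is a value of a ternary form of
determinant `1`, hence a sum of three squares. -/
theorem exists_sum_three_squares_of_dvd (n d b : ℤ) (hd : 0 < d) (hn : 0 < d * n - 1)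
    (h : d * n - 1 ∣ b ^ 2 + d) : ∃ u v w : ℤ, n = u ^ 2 + v ^ 2 + w ^ 2 := by
  obtain ⟨a, ha⟩ := h
  have ha0 : 0 < a := by
    by_contra hle
    push Not at hle
    nlinarith [sq_nonneg b]
  -- The form `a x² + (d n - 1) y² + n z² + 2 x z + 2 b x y`, evaluated at `(0, 0, 1)`.
  obtain ⟨u, v, w, h⟩ := exists_sum_three_squares_of_ternary_det_one a.toNat a (d * n - 1) n 0 1 b
    ha0 (by omega) (by linarith) (by linear_combination -n * ha) 0 0 1
  exact ⟨u, v, w, by linear_combination h⟩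

theorem exists_dvd_sq_add_of_jacobiSym (p d : ℕ) (hp : p.Prime)
    (h : jacobiSym (-d) p = 1) : ∃ b : ℤ, (p : ℤ) ∣ b ^ 2 + d := by
  have := Fact.mk hp
  rw [← jacobiSym.legendreSym.to_jacobiSym] at h
  have h0 : ((-d : ℤ) : ZMod p) ≠ 0 := by
    intro h0
    rw [(legendreSym.eq_zero_iff p _).mpr h0] at h
    exact zero_ne_one h
  obtain ⟨y, hy⟩ := (legendreSym.eq_one_iff p h0).mp h
  obtain ⟨b, rfl⟩ := ZMod.intCast_surjective y
  refine ⟨b, ?_⟩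
  rw [← ZMod.intCast_zmod_eq_zero_iff_dvd]
  push_cast at hy ⊢
  rw [sq, ← hy]; ring

/-- The odd case of the choice of a modulus: `d n - 1` is twice a prime `p`. -/
theorem exists_sum_three_squares_of_two_mul_prime (n d p : ℕ) (hp : p.Prime) (hd : Odd d)
    (hp2 : Odd p) (h : 2 * p + 1 = d * n) (hJ : jacobiSym (-d) p = 1) :
    ∃ u v w : ℤ, (n : ℤ) = u ^ 2 + v ^ 2 + w ^ 2 := by
  obtain ⟨b, hb⟩ := exists_dvd_sq_add_of_jacobiSym p d hp hJ
  have hh : (d : ℤ) * n - 1 = 2 * p := by push_cast [← Nat.cast_mul, ← h]; ring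
  -- Replacing `b` by `b + p` if necessary makes `b ^ 2 + d` even.
  obtain ⟨b, hb, hbo⟩ : ∃ b : ℤ, (p : ℤ) ∣ b ^ 2 + d ∧ Odd b := by
    rcases Int.even_or_odd b with he | ho
    · refine ⟨b + p, ?_, he.add_odd (by exact_mod_cast hp2)⟩
      have : (b + p) ^ 2 + d = (b ^ 2 + d) + p * (2 * b + p) := by ring
      rw [this]
      exact dvd_add hb (dvd_mul_right _ _)
    · exact ⟨b, hb, ho⟩
  refine exists_sum_three_squares_of_dvd n d b (by exact_mod_cast hd.pos) ?_ ?_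
  · rw [hh]; have := hp.pos; omega
  · rw [hh]
    refine IsCoprime.mul_dvd ?_ ?_ hb
    · exact_mod_cast (Nat.coprime_two_left.mpr hp2).isCoprime
    · exact ((hbo.pow).add_odd (by exact_mod_cast hd)).two_dvd

theorem jacobiSym_eq_one_of_dvd_add_one {p d : ℕ} (hd : d % 4 = 1) (hp : Odd p) (h : d ∣ p + 1) :
    jacobiSym (-d) p = jacobiSym (-1) p := by
  have hdo : Odd d := Nat.odd_iff.mpr (by omega)
  rw [jacobiSym.neg _ hp, jacobiSym.quadratic_reciprocity_one_mod_four hd hp,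
    jacobiSym.at_neg_one hp]
  have : jacobiSym p d = jacobiSym (-1) d := by
    apply jacobiSym.mod_left'
    apply Int.ModEq.eq
    rw [Int.modEq_comm, Int.modEq_iff_dvd]
    simpa using (by exact_mod_cast h : (d : ℤ) ∣ p + 1)
  rw [this, jacobiSym.at_neg_one hdo, ZMod.χ₄_nat_one_mod_four hd, mul_one]

/-- Dirichlet's theorem provides a prime `p = d n - 1 ≡ 1 (mod 4)` with `d ≡ 1 (mod 4)`; then
`(-d / p) = (p / d) = (-1 / d) = 1`. -/
theorem exists_sum_three_squares_of_two_mod_four (n : ℕ) (hn : n % 4 = 2) :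
    ∃ u v w : ℤ, (n : ℤ) = u ^ 2 + v ^ 2 + w ^ 2 := by
  have hcop : (n - 1).Coprime (4 * n) := by
    apply Nat.Coprime.mul_right
    · exact (Nat.Coprime.pow_right 2 (Nat.coprime_two_right.mpr (Nat.odd_iff.mpr (by omega))) :
        (n - 1).Coprime (2 ^ 2))
    · rw [Nat.coprime_comm, Nat.coprime_self_sub_right (by omega)]
      exact Nat.coprime_one_right n
  obtain ⟨p, hpn, hp, hmod⟩ := Nat.forall_exists_prime_gt_and_modEq n (by omega) hcop
  obtain ⟨v, hv⟩ := (Nat.modEq_iff_dvd' (by omega)).mp hmod.symm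
  have hpd : p + 1 = (4 * v + 1) * n := by
    have : p + 1 = 4 * n * v + n := by omega
    rw [this]; ring
  have hp4 : p % 4 = 1 := by
    have : p + 1 = 4 * (n * v) + n := by rw [hpd]; ring
    omega
  have hpo : Odd p := Nat.odd_iff.mpr (by omega)
  obtain ⟨b, hb⟩ := exists_dvd_sq_add_of_jacobiSym p (4 * v + 1) hp (by
    rw [jacobiSym_eq_one_of_dvd_add_one (by omega) hpo (hpd ▸ dvd_mul_right _ _),
      jacobiSym.at_neg_one hpo, ZMod.χ₄_nat_one_mod_four hp4])
  have hh : ((4 * v + 1 : ℕ) : ℤ) * n - 1 = p := by rw [← Nat.cast_mul, ← hpd]; push_cast; ring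
  exact exists_sum_three_squares_of_dvd n (4 * v + 1 : ℕ) b (by positivity)
    (by rw [hh]; exact_mod_cast hp.pos) (by rwa [hh])

/-- Reciprocity turns `(-d / p)` into `(p / d)`, which equals `(-2 p / d) = (1 / d)` because
`(-2 / d) = 1` for `d ≡ 3 (mod 8)`. -/
theorem jacobiSym_neg_eq_one_of_two_mul_add_one {p d : ℕ} (hd : d % 8 = 3) (hp : Odd p)
    (h : d ∣ 2 * p + 1) : jacobiSym (-d) p = 1 := by
  have hdo : Odd d := Nat.odd_iff.mpr (by omega)
  have h2 : jacobiSym (-2) d = 1 := by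
    rw [jacobiSym.at_neg_two hdo, ZMod.χ₈'_nat_eq_if_mod_eight]
    simp [hd]; omega
  have h1 : jacobiSym p d = 1 := by
    have : jacobiSym (-2 * p) d = jacobiSym 1 d := by
      apply jacobiSym.mod_left'
      apply Int.ModEq.eq
      rw [Int.modEq_iff_dvd]
      have h' : (d : ℤ) ∣ 2 * p + 1 := by exact_mod_cast h
      convert h' using 1; ring
    rwa [jacobiSym.mul_left, h2, one_mul, jacobiSym.one_left] at this
  rw [jacobiSym.neg _ hp]
  rcases (show p % 4 = 1 ∨ p % 4 = 3 by have := Nat.odd_iff.mp hp; omega) with h4 | h4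
  · rw [jacobiSym.quadratic_reciprocity_one_mod_four' hdo h4, h1, ZMod.χ₄_nat_one_mod_four h4,
      one_mul]
  · rw [jacobiSym.quadratic_reciprocity_three_mod_four (by omega) h4, h1,
      ZMod.χ₄_nat_three_mod_four h4]
    norm_num

/-- Dirichlet's theorem provides an odd prime `p` with `2 p = d n - 1` and `d ≡ 3 (mod 8)`. -/
theorem exists_sum_three_squares_of_one_mod_four (n : ℕ) (hn : n % 4 = 1) :
    ∃ u v w : ℤ, (n : ℤ) = u ^ 2 + v ^ 2 + w ^ 2 := by
  obtain ⟨e, he⟩ : ∃ e, 2 * e + 1 = 3 * n := ⟨(3 * n - 1) / 2, by omega⟩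
  have hcop : e.Coprime (4 * n) := by
    apply Nat.Coprime.mul_right
    · exact (Nat.Coprime.pow_right 2 (Nat.coprime_two_right.mpr (Nat.odd_iff.mpr (by omega))) :
        e.Coprime (2 ^ 2))
    · rw [Nat.coprime_comm]
      apply Nat.Coprime.coprime_mul_left (k := 3)
      rw [← he]
      simp
  obtain ⟨p, hpn, hp, hmod⟩ := Nat.forall_exists_prime_gt_and_modEq e (by omega) hcop
  obtain ⟨v, hv⟩ := (Nat.modEq_iff_dvd' (by omega)).mp hmod.symm
  have hpd : 2 * p + 1 = (8 * v + 3) * n := by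
    have : 2 * p + 1 = 2 * (4 * n * v) + 3 * n := by omega
    rw [this]; ring
  have hpo : Odd p := by
    have : p = 4 * (n * v) + e := by rw [← mul_assoc]; omega
    exact Nat.odd_iff.mpr (by omega)
  exact exists_sum_three_squares_of_two_mul_prime n (8 * v + 3) p hp
    (Nat.odd_iff.mpr (by omega)) hpo hpd
    (jacobiSym_neg_eq_one_of_two_mul_add_one (by omega) hpo (hpd ▸ dvd_mul_right _ _))

/-- The part of Legendre's three-square theorem that concerns integers `≡ 1, 2 (mod 4)`. -/
theorem exists_sum_three_squares (n : ℤ) (h0 : 0 ≤ n) (hn : n % 4 = 1 ∨ n % 4 = 2) :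
    ∃ u v w : ℤ, n = u ^ 2 + v ^ 2 + w ^ 2 := by
  lift n to ℕ using h0
  rcases hn with h | h
  · exact exists_sum_three_squares_of_one_mod_four n (by omega)
  · exact exists_sum_three_squares_of_two_mod_four n (by omega)

/-! ### A signed count of triangular numbers plus products -/

theorem triangular_neg_one_sub (x : ℤ) : triangular (-1 - x) = triangular x := by
  have h1 := two_mul_triangular (-1 - x)
  have h2 := two_mul_triangular x
  linarith

theorem triangular_nonneg (x : ℤ) : 0 ≤ triangular x := by
  have h := two_mul_triangular x
  rcases le_or_gt 0 x with h0 | h0 <;> nlinarith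

theorem abs_le_triangular_add_one (x : ℤ) : |x| ≤ triangular x + 1 := by
  have h := two_mul_triangular x
  rw [abs_le]
  rcases le_or_gt 0 x with h0 | h0
  · constructor <;> nlinarith [sq_nonneg (2 * x - 1)]
  · constructor <;> nlinarith [mul_nonneg (show 0 ≤ -1 - x by omega) (show 0 ≤ -1 - x by omega)]

/-- The solutions `(z, d, δ)` of `T_z + d δ = n` with `d` and `δ` positive. -/
noncomputable def triangularProductReps (n : ℤ) : Finset (ℤ × ℤ × ℤ) :=
  (Finset.Icc (-(n + 1)) (n + 1) ×ˢ Finset.Icc 1 n ×ˢ Finset.Icc 1 n).filter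
    fun a => triangular a.1 + a.2.1 * a.2.2 = n

theorem mem_triangularProductReps {n z d δ : ℤ} :
    (z, d, δ) ∈ triangularProductReps n ↔ 0 < d ∧ 0 < δ ∧ triangular z + d * δ = n := by
  simp only [triangularProductReps, Finset.mem_filter, Finset.mem_product, Finset.mem_Icc]
  constructor
  · rintro ⟨⟨-, ⟨h1, -⟩, h2, -⟩, h⟩
    exact ⟨by omega, by omega, h⟩
  · rintro ⟨h1, h2, h⟩
    have h3 := triangular_nonneg z
    have h4 := abs_le.mp (abs_le_triangular_add_one z)
    have h5 : 0 < d * δ := mul_pos h1 h2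
    exact ⟨⟨⟨by linarith, by linarith⟩, ⟨by omega, by nlinarith⟩, by omega, by nlinarith⟩, h⟩

/-- The map behind the cancellation. In the variables `e = z + d` and `f = 2 δ - 2 z - d - 1` the
equation `T_z + d δ = n` reads `d f = 2 (n - T_e)`, where `d` and `f` have opposite parity and
`f - d = 2 δ - (2 e + 1)`. For `δ ≤ 2 e` the map exchanges `d` and `f` up to sign, and for
`δ > 2 e + 1` it replaces `e` by `-1 - e`. -/
def triangularProductInvolution (a : ℤ × ℤ × ℤ) : ℤ × ℤ × ℤ :=
  let e := a.1 + a.2.1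
  let f := 2 * a.2.2 - 2 * a.1 - a.2.1 - 1
  if a.2.2 ≤ 2 * e then
    if 0 < f then (e - f, f, 2 * e + 1 - a.2.2) else (e + f, -f, a.2.2)
  else (-1 - e - a.2.1, a.2.1, a.2.2 - 2 * e - 1)

theorem triangularProductInvolution_spec {n : ℤ} (hn : ∀ m, n ≠ triangular m) {z d δ : ℤ}
    (h : (z, d, δ) ∈ triangularProductReps n) :
    triangularProductInvolution (z, d, δ) ∈ triangularProductReps n ∧
    triangularProductInvolution (triangularProductInvolution (z, d, δ)) = (z, d, δ) ∧
    Odd ((triangularProductInvolution (z, d, δ)).1 + z) ∧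
    ((triangularProductInvolution (z, d, δ)).1 + (triangularProductInvolution (z, d, δ)).2.1 = z + d
      ∨ (triangularProductInvolution (z, d, δ)).1 + (triangularProductInvolution (z, d, δ)).2.1
        = -1 - (z + d)) := by
  rw [mem_triangularProductReps] at h
  obtain ⟨hd, hδ, h⟩ := h
  have hz := two_mul_triangular z
  -- `f = 0` would give `n = T_{z + d}`.
  have hf : 2 * δ - 2 * z - d - 1 ≠ 0 := by
    intro hf
    apply hn (z + d)
    have := two_mul_triangular (z + d)
    nlinarith
  -- `δ = 2 e + 1` would give `n = T_{z + 2 d}`.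
  have hδe : δ ≠ 2 * (z + d) + 1 := by
    intro hδe
    apply hn (z + 2 * d)
    have := two_mul_triangular (z + 2 * d)
    rw [hδe] at h
    linarith
  by_cases h1 : δ ≤ 2 * (z + d)
  · by_cases h2 : 0 < 2 * δ - 2 * z - d - 1
    · have hv : triangularProductInvolution (z, d, δ) =
          (z + d - (2 * δ - 2 * z - d - 1), 2 * δ - 2 * z - d - 1, 2 * (z + d) + 1 - δ) := by
        simp only [triangularProductInvolution, if_pos h1, if_pos h2]
      rw [hv, mem_triangularProductReps]
      refine ⟨⟨h2, by omega, ?_⟩, ?_, ⟨2 * z + d - δ, by ring⟩, Or.inl (by ring)⟩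
      · have := two_mul_triangular (z + d - (2 * δ - 2 * z - d - 1))
        linarith
      · simp only [triangularProductInvolution]
        rw [if_pos (by omega), if_pos (by omega)]
        ext <;> simp only <;> ring
    · have hv : triangularProductInvolution (z, d, δ) =
          (z + d + (2 * δ - 2 * z - d - 1), -(2 * δ - 2 * z - d - 1), δ) := by
        simp only [triangularProductInvolution, if_pos h1, if_neg h2]
      rw [hv, mem_triangularProductReps]
      refine ⟨⟨by omega, hδ, ?_⟩, ?_, ⟨δ - 1, by ring⟩, Or.inl (by ring)⟩
      · have := two_mul_triangular (z + d + (2 * δ - 2 * z - d - 1))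
        linarith
      · simp only [triangularProductInvolution]
        rw [if_pos (by omega), if_neg (by omega)]
        ext <;> simp only <;> ring
  · have hv : triangularProductInvolution (z, d, δ) =
        (-1 - (z + d) - d, d, δ - 2 * (z + d) - 1) := by
      simp only [triangularProductInvolution, if_neg h1]
    rw [hv, mem_triangularProductReps]
    refine ⟨⟨hd, by omega, ?_⟩, ?_, ⟨-1 - d, by ring⟩, Or.inr (by ring)⟩
    · have := two_mul_triangular (-1 - (z + d) - d)
      linarith
    · simp only [triangularProductInvolution]
      rw [if_neg (by omega)]
      ext <;> simp only <;> ring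

theorem sum_triangularProductReps_eq_zero {n : ℤ} (hn : ∀ m, n ≠ triangular m) (g : ℤ → ℤ)
    (hg : ∀ e, g (-1 - e) = g e) :
    ∑ a ∈ triangularProductReps n, (a.1.negOnePow : ℤ) * g (a.1 + a.2.1) = 0 := by
  have hsign : ∀ a ∈ triangularProductReps n,
      ((triangularProductInvolution a).1.negOnePow : ℤ) = -(a.1.negOnePow : ℤ) := by
    rintro ⟨z, d, δ⟩ ha
    have h := (triangularProductInvolution_spec hn ha).2.2.1
    have h2 : (triangularProductInvolution (z, d, δ)).1 =
        ((triangularProductInvolution (z, d, δ)).1 + z) - z := by ring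
    rw [h2, Int.negOnePow_sub, Int.negOnePow_odd _ h]
    simp
  refine Finset.sum_involution (fun a _ => triangularProductInvolution a) ?_ ?_ ?_ ?_
  · intro a ha
    rw [hsign a ha]
    obtain ⟨z, d, δ⟩ := a
    rcases (triangularProductInvolution_spec hn ha).2.2.2 with h | h
    · rw [h]; ring
    · rw [h, hg]; ring
  · intro a ha _ heq
    have h := hsign a ha
    rw [heq] at h
    rcases Int.units_eq_one_or a.1.negOnePow with h1 | h1 <;> rw [h1] at h <;> simp at h
  · rintro ⟨z, d, δ⟩ ha
    exact (triangularProductInvolution_spec hn ha).1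
  · rintro ⟨z, d, δ⟩ ha
    exact (triangularProductInvolution_spec hn ha).2.1

theorem sum_triangularProductReps_neg_one_sub (n : ℤ) (F : ℤ → ℤ → ℤ) :
    ∑ a ∈ triangularProductReps n, F (-1 - a.1) a.2.1 =
      ∑ a ∈ triangularProductReps n, F a.1 a.2.1 := by
  refine Finset.sum_nbij' (fun a => (-1 - a.1, a.2)) (fun a => (-1 - a.1, a.2)) ?_ ?_ ?_ ?_ ?_
  · rintro ⟨z, d, δ⟩ h
    simpa only [mem_triangularProductReps, triangular_neg_one_sub] using h
  · rintro ⟨z, d, δ⟩ h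
    simpa only [mem_triangularProductReps, triangular_neg_one_sub] using h
  · rintro ⟨z, d, δ⟩ _
    simp
  · rintro ⟨z, d, δ⟩ _
    simp
  · rintro ⟨z, d, δ⟩ _
    rfl

/-- The function of period `4` with values `0, 1, 1, 0`; it is symmetric under `e ↦ -1 - e`. -/
def oneTwoModFour (e : ℤ) : ℤ := if e % 4 = 1 ∨ e % 4 = 2 then 1 else 0

/-- Differences of `oneTwoModFour` produce the character `χ₄`: this is the specialization that extracts
`∑ χ₄(d)` from the cancellation for arbitrary symmetric `g`. -/
theorem negOnePow_mul_oneTwoModFour_sub (z d : ℤ) :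
    (z.negOnePow : ℤ) * (oneTwoModFour (z + d) - oneTwoModFour (z - d)) =
      ((triangular z).negOnePow : ℤ) * ZMod.χ₄ d := by
  have hT := two_mul_triangular z
  have hχ : ZMod.χ₄ d = if d % 2 = 0 then 0 else if d % 4 = 1 then 1 else -1 :=
    ZMod.χ₄_int_eq_if_mod_four d
  have hpar : (triangular z) % 2 = if z % 4 = 0 ∨ z % 4 = 3 then 0 else 1 := by
    obtain ⟨k, hk⟩ : ∃ k, k = z / 4 := ⟨_, rfl⟩
    rcases (show z = 4 * k ∨ z = 4 * k + 1 ∨ z = 4 * k + 2 ∨ z = 4 * k + 3 by omega) with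
      h | h | h | h
    · have : triangular z = 2 * (k * (4 * k + 1)) := by rw [h] at hT ⊢; linarith
      rw [if_pos (by omega)]; omega
    · have : triangular z = 2 * (4 * k ^ 2 + 3 * k) + 1 := by rw [h] at hT ⊢; linarith
      rw [if_neg (by omega)]; omega
    · have : triangular z = 2 * (4 * k ^ 2 + 5 * k + 1) + 1 := by rw [h] at hT ⊢; linarith
      rw [if_neg (by omega)]; omega
    · have : triangular z = 2 * ((4 * k + 3) * (k + 1)) := by rw [h] at hT ⊢; linarith
      rw [if_pos (by omega)]; omega
  have hs : ∀ x : ℤ, (x.negOnePow : ℤ) = if x % 2 = 0 then 1 else -1 := by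
    intro x
    split_ifs with h
    · rw [Int.negOnePow_even x (Int.even_iff.mpr h)]; rfl
    · rw [Int.negOnePow_odd x (Int.odd_iff.mpr (by omega))]; rfl
  rw [hχ, hs, hs, hpar, oneTwoModFour, oneTwoModFour]
  have h4 : z % 4 = 0 ∨ z % 4 = 1 ∨ z % 4 = 2 ∨ z % 4 = 3 := by omega
  have h4' : d % 4 = 0 ∨ d % 4 = 1 ∨ d % 4 = 2 ∨ d % 4 = 3 := by omega
  have e1 : (z + d) % 4 = (z % 4 + d % 4) % 4 := by omega
  have e2 : (z - d) % 4 = (z % 4 - d % 4) % 4 := by omega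
  have e3 : z % 2 = z % 4 % 2 := by omega
  have e4 : d % 2 = d % 4 % 2 := by omega
  rw [e1, e2, e3, e4]
  rcases h4 with h | h | h | h <;> rcases h4' with h' | h' | h' | h' <;> rw [h, h'] <;> decide

/-- If `n` is not triangular, then `∑ (-1) ^ T_z χ₄(d)` over all solutions of `T_z + d δ = n` with
`d, δ > 0` vanishes. -/
theorem sum_negOnePow_triangular_mul_χ₄_eq_zero {n : ℤ} (hn : ∀ m, n ≠ triangular m) :
    ∑ a ∈ triangularProductReps n, ((triangular a.1).negOnePow : ℤ) * ZMod.χ₄ a.2.1 = 0 := by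
  have hg : ∀ e, oneTwoModFour (-1 - e) = oneTwoModFour e := by
    intro e
    unfold oneTwoModFour
    congr 1
    apply propext
    omega
  have h0 := sum_triangularProductReps_eq_zero hn oneTwoModFour hg
  have h1 := sum_triangularProductReps_neg_one_sub n
    (fun z d => (z.negOnePow : ℤ) * oneTwoModFour (z + d))
  have h2 : ∀ z d : ℤ, ((-1 - z).negOnePow : ℤ) * oneTwoModFour (-1 - z + d) =
      -((z.negOnePow : ℤ) * oneTwoModFour (z - d)) := by
    intro z d
    rw [← hg (z - d), show -1 - (z - d) = -1 - z + d by ring, Int.negOnePow_sub]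
    simp
  simp only [h2] at h1
  rw [h0] at h1
  simp only [← negOnePow_mul_oneTwoModFour_sub, mul_sub, Finset.sum_sub_distrib]
  rw [Finset.sum_neg_distrib] at h1
  linarith

/-! ### The divisor sum of the character modulo 4 -/

/-- The arithmetic function `k ↦ ∑_{d ∣ k} χ₄(d)`, a quarter of the number of representations
of `k > 0` as a sum of two squares. -/
def χ₄DivisorSum : ArithmeticFunction ℤ :=
  (ArithmeticFunction.zeta : ArithmeticFunction ℤ) *
    ⟨fun n => ZMod.χ₄ n, by simp⟩

theorem χ₄DivisorSum_apply (n : ℕ) : χ₄DivisorSum n = ∑ d ∈ n.divisors, ZMod.χ₄ d :=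
  ArithmeticFunction.coe_zeta_mul_apply

theorem isMultiplicative_χ₄DivisorSum : χ₄DivisorSum.IsMultiplicative := by
  refine ArithmeticFunction.isMultiplicative_zeta.natCast.mul
    ⟨by simp, fun _ => by simp only [ArithmeticFunction.coe_mk, Nat.cast_mul, map_mul]⟩

theorem χ₄DivisorSum_prime_pow {p : ℕ} (hp : p.Prime) (k : ℕ) :
    0 ≤ χ₄DivisorSum (p ^ k) ∧ (χ₄DivisorSum (p ^ k) ≠ 0 ↔ (p % 4 = 3 → Even k)) := by
  rw [χ₄DivisorSum_apply, Nat.sum_divisors_prime_pow hp]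
  simp only [Nat.cast_pow, map_pow]
  rcases hp.eq_two_or_odd with rfl | ho
  · have h2 : ZMod.χ₄ ((2 : ℕ) : ZMod 4) = 0 := by decide
    simp only [h2]
    have : ∑ i ∈ Finset.range (k + 1), (0 : ℤ) ^ i = 1 := by
      rw [Finset.sum_range_succ']; simp
    rw [this]; simp
  · rcases (show p % 4 = 1 ∨ p % 4 = 3 by omega) with h | h
    · rw [ZMod.χ₄_nat_one_mod_four h]
      simp [h]
      omega
    · rw [ZMod.χ₄_nat_three_mod_four h]
      simp only [neg_one_geom_sum, h, true_imp_iff]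
      by_cases hk : Even k
      · simp [hk, Nat.even_add_one]
      · simp [hk, Nat.even_add_one]

theorem χ₄DivisorSum_nonneg (n : ℕ) : 0 ≤ χ₄DivisorSum n := by
  rcases eq_or_ne n 0 with rfl | hn
  · simp
  · rw [isMultiplicative_χ₄DivisorSum.multiplicative_factorization _ hn]
    exact Finset.prod_nonneg fun p hp =>
      (χ₄DivisorSum_prime_pow (Nat.prime_of_mem_primeFactors hp) _).1

theorem χ₄DivisorSum_ne_zero_iff {n : ℕ} (hn : n ≠ 0) :
    χ₄DivisorSum n ≠ 0 ↔ ∃ x y : ℕ, n = x ^ 2 + y ^ 2 := by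
  rw [Nat.eq_sq_add_sq_iff, isMultiplicative_χ₄DivisorSum.multiplicative_factorization _ hn,
    Finsupp.prod, Finset.prod_ne_zero_iff]
  refine forall₂_congr fun p hp => ?_
  have hp' := Nat.prime_of_mem_primeFactors hp
  rw [(χ₄DivisorSum_prime_pow hp' _).2, Nat.factorization_def _ hp']

/-! ### Squares and triangular numbers with a parity condition -/

theorem sum_χ₄_fiber (n z : ℤ) (hz : triangular z < n) :
    ∑ a ∈ (triangularProductReps n).filter (fun a => a.1 = z), ZMod.χ₄ a.2.1 =
      χ₄DivisorSum (n - triangular z).toNat := by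
  have hpos : 0 < n - triangular z := by linarith
  rw [χ₄DivisorSum_apply]
  refine Finset.sum_bij' (fun a _ => a.2.1.toNat)
    (fun d _ => (z, (d : ℤ), (n - triangular z) / d)) ?_ ?_ ?_ ?_ ?_
  · rintro ⟨z', d, δ⟩ h
    rw [Finset.mem_filter, mem_triangularProductReps] at h
    obtain ⟨⟨hd, hδ, h⟩, rfl⟩ := h
    rw [Nat.mem_divisors]
    refine ⟨?_, by omega⟩
    zify
    rw [Int.toNat_of_nonneg hd.le, Int.toNat_of_nonneg hpos.le]
    exact ⟨δ, by linarith⟩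
  · intro d h
    rw [Nat.mem_divisors] at h
    have hd : (d : ℤ) ∣ n - triangular z := by
      have := Int.natCast_dvd_natCast.mpr h.1
      rwa [Int.toNat_of_nonneg hpos.le] at this
    have hd0 : 0 < (d : ℤ) := by
      exact_mod_cast Nat.pos_of_dvd_of_pos h.1 (by omega)
    rw [Finset.mem_filter, mem_triangularProductReps]
    refine ⟨⟨hd0, Int.ediv_pos_of_pos_of_dvd hpos hd0.le hd, ?_⟩, rfl⟩
    rw [Int.mul_ediv_cancel' hd]; ring
  · rintro ⟨z', d, δ⟩ h
    rw [Finset.mem_filter, mem_triangularProductReps] at h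
    obtain ⟨⟨hd, hδ, h⟩, hz'⟩ := h
    simp only at hz'
    subst hz'
    simp only [Int.toNat_of_nonneg hd.le]
    rw [← h, add_sub_cancel_left, Int.mul_ediv_cancel_left _ hd.ne']
  · intro d h
    simp
  · rintro ⟨z', d, δ⟩ h
    rw [Finset.mem_filter, mem_triangularProductReps] at h
    have : ((d.toNat : ℕ) : ℤ) = d := Int.toNat_of_nonneg h.1.1.le
    simp only
    rw [← Int.cast_natCast, this]

theorem sum_negOnePow_triangular_mul_χ₄DivisorSum_eq_zero {n : ℤ} (hn : ∀ m, n ≠ triangular m) :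
    ∑ z ∈ (Finset.Icc (-(n + 1)) (n + 1)).filter (fun z => triangular z < n),
      ((triangular z).negOnePow : ℤ) * χ₄DivisorSum (n - triangular z).toNat = 0 := by
  rw [← sum_negOnePow_triangular_mul_χ₄_eq_zero hn]
  rw [← Finset.sum_fiberwise_of_maps_to (s := triangularProductReps n) (g := fun a => a.1)
    (t := (Finset.Icc (-(n + 1)) (n + 1)).filter (fun z => triangular z < n))]
  · refine Finset.sum_congr rfl fun z hz => ?_
    rw [← sum_χ₄_fiber n z (Finset.mem_filter.mp hz).2, Finset.mul_sum]
    refine Finset.sum_congr rfl fun a ha => ?_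
    rw [(Finset.mem_filter.mp ha).2]
  · rintro ⟨z, d, δ⟩ h
    rw [mem_triangularProductReps] at h
    have h4 := abs_le.mp (abs_le_triangular_add_one z)
    have h5 : 0 < d * δ := mul_pos h.1 h.2.1
    rw [Finset.mem_filter, Finset.mem_Icc]
    refine ⟨⟨by linarith, by linarith⟩, by linarith⟩

/-- The coefficient form of Jacobi's identity
`∑ (-1)^(x+y) q^(x² + y² + T_z) = ∑ (-1)^m (2 m + 1) q^(T_m)` (`x, y ∈ ℤ`, `z, m ≥ 0`), at an exponent that is not
triangular: representations with `x + y` even and with `x + y` odd balance, so one of the first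
kind forces one of the second. -/
theorem exists_odd_add_of_ne_triangular {n : ℤ} (hn : ∀ m, n ≠ triangular m)
    {x y z : ℤ} (h : n = x ^ 2 + y ^ 2 + triangular z) :
    ∃ x y z : ℤ, Odd (x + y) ∧ n = x ^ 2 + y ^ 2 + triangular z := by
  by_contra hcon
  push Not at hcon
  have hkey : ∀ z : ℤ, triangular z < n → χ₄DivisorSum (n - triangular z).toNat ≠ 0 →
      ∃ x y : ℤ, n = x ^ 2 + y ^ 2 + triangular z := by
    intro z hz h0
    obtain ⟨x, y, hxy⟩ := (χ₄DivisorSum_ne_zero_iff (by omega)).mp h0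
    refine ⟨x, y, ?_⟩
    have : (((n - triangular z).toNat : ℕ) : ℤ) = (x : ℤ) ^ 2 + (y : ℤ) ^ 2 := by
      rw [hxy]; push_cast; ring
    rw [Int.toNat_of_nonneg (by linarith)] at this
    linarith
  have hpar : ∀ x y z : ℤ, n = x ^ 2 + y ^ 2 + triangular z →
      (triangular z).negOnePow = n.negOnePow := by
    intro x y z h
    have hev : Even (x ^ 2 + y ^ 2) := by
      by_contra ho
      refine hcon x y z ?_ h
      rw [← Int.not_even_iff_odd]
      simpa [Int.even_add, Int.even_pow] using ho
    rw [h, Int.negOnePow_add, Int.negOnePow_even _ hev, one_mul]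
  have hlt : triangular z < n := by
    have := hn z
    have : triangular z ≤ n := by rw [h]; nlinarith [sq_nonneg x, sq_nonneg y]
    omega
  have hsum := sum_negOnePow_triangular_mul_χ₄DivisorSum_eq_zero hn
  have hsum' : ∑ z ∈ (Finset.Icc (-(n + 1)) (n + 1)).filter (fun z => triangular z < n),
      χ₄DivisorSum (n - triangular z).toNat = 0 := by
    have : (n.negOnePow : ℤ) * ∑ z ∈ (Finset.Icc (-(n + 1)) (n + 1)).filter
        (fun z => triangular z < n), χ₄DivisorSum (n - triangular z).toNat = 0 := by
      rw [← hsum, Finset.mul_sum]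
      refine Finset.sum_congr rfl fun w hw => ?_
      by_cases h0 : χ₄DivisorSum (n - triangular w).toNat = 0
      · rw [h0]; simp
      · obtain ⟨x', y', h'⟩ := hkey w (Finset.mem_filter.mp hw).2 h0
        rw [hpar x' y' w h']
    exact (mul_eq_zero.mp this).resolve_left (Units.ne_zero _)
  have hz0 := (Finset.sum_eq_zero_iff_of_nonneg fun w _ => χ₄DivisorSum_nonneg _).mp hsum' z (by
    have h4 := abs_le.mp (abs_le_triangular_add_one z)
    rw [Finset.mem_filter, Finset.mem_Icc]
    exact ⟨⟨by linarith, by linarith⟩, hlt⟩)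
  refine (χ₄DivisorSum_ne_zero_iff (by omega)).mpr ⟨x.natAbs, y.natAbs, ?_⟩ hz0
  zify
  rw [Int.toNat_of_nonneg (by linarith), sq_abs, sq_abs]
  linarith

theorem eight_mul_add_one_eq {n x y z : ℤ} :
    n = x ^ 2 + y ^ 2 + triangular z ↔
      8 * n + 1 = (2 * z + 1) ^ 2 + 8 * (x ^ 2 + y ^ 2) := by
  have := two_mul_triangular z
  constructor <;> intro h <;> nlinarith

theorem exists_sq_add_sq_add_triangular {n : ℤ} (hn : 0 ≤ n) :
    ∃ x y z : ℤ, n = x ^ 2 + y ^ 2 + triangular z := by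
  obtain ⟨u, v, w, h⟩ := exists_sum_three_squares (8 * n + 1) (by omega) (by omega)
  -- It suffices to treat the case that `u` is the odd one; then `v` and `w` are even and `v ≡ w (mod 4)`.
  have key : ∀ u v w : ℤ, 8 * n + 1 = u ^ 2 + v ^ 2 + w ^ 2 → Odd u →
      ∃ x y z : ℤ, n = x ^ 2 + y ^ 2 + triangular z := by
    rintro u v w h ⟨j, rfl⟩
    have hj : Even (j * (j + 1)) := Int.even_mul_succ_self j
    obtain ⟨i, hi⟩ := hj
    have hsum : v ^ 2 + w ^ 2 = 8 * (n - i) := by linear_combination -4 * hi - h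
    have hv : Even v ∧ Even w := by
      rcases Int.even_or_odd' v with ⟨a, rfl | rfl⟩ <;> rcases Int.even_or_odd' w with ⟨b, rfl | rfl⟩
      · exact ⟨even_two_mul a, even_two_mul b⟩
      · exfalso; ring_nf at hsum; omega
      · exfalso; ring_nf at hsum; omega
      · exfalso; ring_nf at hsum; omega
    obtain ⟨⟨a, rfl⟩, ⟨b, rfl⟩⟩ := hv
    have hab : Even (a + b) := by
      have h2 : a ^ 2 + b ^ 2 = 2 * (n - i) := by linarith
      have : Even (a ^ 2 + b ^ 2) := h2 ▸ even_two_mul _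
      simpa [Int.even_add, Int.even_pow] using this
    obtain ⟨s, hs⟩ := hab
    refine ⟨s, a - s, j, eight_mul_add_one_eq.mpr ?_⟩
    obtain rfl : b = s + s - a := by linarith
    linear_combination h
  rcases Int.even_or_odd' u with ⟨a, rfl | rfl⟩
  · rcases Int.even_or_odd' v with ⟨b, rfl | rfl⟩
    · rcases Int.even_or_odd' w with ⟨c, rfl | rfl⟩
      · exfalso; ring_nf at h; omega
      · exact key (2 * c + 1) (2 * a) (2 * b) (by linarith) ⟨c, rfl⟩
    · exact key (2 * b + 1) (2 * a) w (by linarith) ⟨b, rfl⟩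
  · exact key _ v w h ⟨a, rfl⟩

/-! ### Representations of the square of an odd number -/

/-- If `A B` is a sum of two squares and no prime `q ≡ 3 (mod 4)` divides both factors, then `A`
is a sum of two squares, because every such `q` divides it to an even power. -/
theorem exists_sq_add_sq_of_mul {A B : ℕ} (hA : 0 < A) (hB : 0 < B)
    (h : ∃ x y : ℕ, A * B = x ^ 2 + y ^ 2)
    (hq : ∀ q : ℕ, q.Prime → q % 4 = 3 → q ∣ A → ¬ q ∣ B) : ∃ x y : ℕ, A = x ^ 2 + y ^ 2 := by
  rw [Nat.eq_sq_add_sq_iff] at h ⊢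
  intro q hqA hq4
  have hqp := Nat.prime_of_mem_primeFactors hqA
  have hdvd := Nat.dvd_of_mem_primeFactors hqA
  have := Fact.mk hqp
  have h1 := h q (Nat.mem_primeFactors.mpr ⟨hqp, hdvd.mul_right B, by positivity⟩) hq4
  rwa [padicValNat.mul hA.ne' hB.ne',
    padicValNat.eq_zero_of_not_dvd (hq q hqp hq4 hdvd), add_zero] at h1

theorem mod_four_ne_three_of_eq_sq_add_sq {A : ℕ} (h : ∃ x y : ℕ, A = x ^ 2 + y ^ 2) :
    A % 4 ≠ 3 := by
  obtain ⟨x, y, rfl⟩ := h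
  obtain ⟨a, rfl | rfl⟩ := Nat.even_or_odd' x <;> obtain ⟨b, rfl | rfl⟩ := Nat.even_or_odd' y <;>
    ring_nf <;> omega

/-- The complementary factors `(N - w) / 2` and `(N + w) / 2` of `x² + y²`. -/
theorem exists_factors_of_sq_eq {N : ℕ} {w x y : ℤ} (hN : Odd N)
    (h : (N : ℤ) ^ 2 = w ^ 2 + 4 * (x ^ 2 + y ^ 2)) (hx : x ≠ 0) :
    ∃ A B : ℕ, 0 < A ∧ 0 < B ∧ A + B = N ∧ ((A * B : ℕ) : ℤ) = x ^ 2 + y ^ 2 := by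
  have hx2 : 0 < x ^ 2 := by positivity
  have hw : Odd w := by
    have h1 : Odd (w ^ 2 + 4 * (x ^ 2 + y ^ 2)) := h ▸ (by exact_mod_cast hN.pow)
    have h2 : Even (4 * (x ^ 2 + y ^ 2)) := ⟨2 * (x ^ 2 + y ^ 2), by ring⟩
    by_contra hc
    rw [Int.not_odd_iff_even] at hc
    exact (Int.not_odd_iff_even.mpr ((hc.pow_of_ne_zero two_ne_zero).add h2)) h1
  have hlt := abs_lt_of_sq_lt_sq (show w ^ 2 < (N : ℤ) ^ 2 by nlinarith [sq_nonneg y])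
    (by positivity)
  rw [abs_lt] at hlt
  obtain ⟨i, hi⟩ := hN
  obtain ⟨j, hj⟩ := hw
  have e1 : (((i - j : ℤ).toNat : ℕ) : ℤ) = i - j := Int.toNat_of_nonneg (by omega)
  have e2 : (((i + j + 1 : ℤ).toNat : ℕ) : ℤ) = i + j + 1 := Int.toNat_of_nonneg (by omega)
  refine ⟨(i - j : ℤ).toNat, (i + j + 1 : ℤ).toNat, by omega, by omega, by omega, ?_⟩
  rw [Nat.cast_mul, e1, e2]
  have hi' : (N : ℤ) = 2 * i + 1 := by exact_mod_cast hi
  rw [hi', hj] at h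
  linarith

theorem exists_natAbs_sq_add_sq {A : ℕ} {x y : ℤ} (h : (A : ℤ) = x ^ 2 + y ^ 2) :
    ∃ u v : ℕ, A = u ^ 2 + v ^ 2 :=
  ⟨x.natAbs, y.natAbs, by zify; rw [sq_abs, sq_abs, h]⟩

/-- The square of a prime `p ≡ 3 (mod 4)` is not `w² + 8 (x² + y²)` with `x`, `y` odd: both
factors of `(p - w) / 2 * ((p + w) / 2) = (x + y)² + (x - y)²` would be sums of two squares, one
odd and the other divisible by `4`, so that their sum `p` would be `1` modulo `4`. -/
theorem not_sq_eq_of_prime {p : ℕ} (hp : p.Prime) (h4 : p % 4 = 3) {w x y : ℤ} (hx : Odd x)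
    (hy : Odd y) (h : (p : ℤ) ^ 2 = w ^ 2 + 8 * (x ^ 2 + y ^ 2)) : False := by
  obtain ⟨a, ha⟩ := hx
  obtain ⟨b, hb⟩ := hy
  obtain ⟨A, B, hA, hB, hAB, hprod⟩ : ∃ A B : ℕ, 0 < A ∧ 0 < B ∧ A + B = p ∧
      ((A * B : ℕ) : ℤ) = (x + y) ^ 2 + (x - y) ^ 2 := by
    have hodd : Odd p := Nat.odd_iff.mpr (by omega)
    -- `x + y` and `x - y` are not both zero.
    by_cases h0 : x + y = 0
    · obtain ⟨A, B, h1, h2, h3, h4⟩ := exists_factors_of_sq_eq (w := w) (x := x - y) (y := x + y)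
        hodd (by rw [h]; ring) (by omega)
      exact ⟨A, B, h1, h2, h3, by rw [h4]; ring⟩
    · exact exists_factors_of_sq_eq (w := w) hodd (by rw [h]; ring) h0
  have hq : ∀ q : ℕ, q.Prime → q % 4 = 3 → q ∣ A → ¬ q ∣ B := by
    intro q hqp _ h1 h2
    have : q = p := (Nat.prime_dvd_prime_iff_eq hqp hp).mp (hAB ▸ dvd_add h1 h2)
    have := Nat.le_of_dvd hA h1
    omega
  have hA3 := mod_four_ne_three_of_eq_sq_add_sq
    (exists_sq_add_sq_of_mul hA hB (exists_natAbs_sq_add_sq hprod) hq)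
  have hB3 := mod_four_ne_three_of_eq_sq_add_sq
    (exists_sq_add_sq_of_mul hB hA (exists_natAbs_sq_add_sq (mul_comm A B ▸ hprod))
      fun q h1 h2 h3 h4 => hq q h1 h2 h4 h3)
  have hmod : A * B % 4 = 0 := by
    have : ((A * B : ℕ) : ℤ) = 4 * (2 * (a ^ 2 + b ^ 2 + a + b) + 1) := by
      rw [hprod, ha, hb]; ring
    omega
  rw [Nat.mul_mod] at hmod
  have : A % 4 = 0 ∨ A % 4 = 1 ∨ A % 4 = 2 := by omega
  have : B % 4 = 0 ∨ B % 4 = 1 ∨ B % 4 = 2 := by omega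
  rcases ‹A % 4 = 0 ∨ A % 4 = 1 ∨ A % 4 = 2› with h1 | h1 | h1 <;>
    rcases ‹B % 4 = 0 ∨ B % 4 = 1 ∨ B % 4 = 2› with h2 | h2 | h2 <;>
    rw [h1, h2] at hmod <;> omega

/-- If no prime `≡ 3 (mod 4)` divides `N`, then `N²` is not `w² + 4 x² + 4 y²` with `x`, `y` odd:
the factors `(N - w) / 2` and `(N + w) / 2` of `x² + y² ≡ 2 (mod 4)` would be sums of two squares,
one odd and the other even, so that their sum `N` would be `3` modulo `4`; but `N` itself is a sum of
two squares. -/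
theorem not_sq_eq_of_forall_prime {N : ℕ} (hN : Odd N)
    (hq : ∀ q : ℕ, q.Prime → q ∣ N → q % 4 ≠ 3) {w x y : ℤ} (hx : Odd x)
    (hy : Odd y) (h : (N : ℤ) ^ 2 = w ^ 2 + 4 * (x ^ 2 + y ^ 2)) : False := by
  obtain ⟨A, B, hA, hB, hAB, hprod⟩ := exists_factors_of_sq_eq hN h (by rintro rfl; simp at hx)
  have hq' : ∀ q : ℕ, q.Prime → q % 4 = 3 → q ∣ A → ¬ q ∣ B := fun q hqp h4 h1 h2 =>
    hq q hqp (hAB ▸ dvd_add h1 h2) h4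
  have hA3 := mod_four_ne_three_of_eq_sq_add_sq
    (exists_sq_add_sq_of_mul hA hB (exists_natAbs_sq_add_sq hprod) hq')
  have hB3 := mod_four_ne_three_of_eq_sq_add_sq
    (exists_sq_add_sq_of_mul hB hA (exists_natAbs_sq_add_sq (mul_comm A B ▸ hprod))
      fun q h1 h2 h3 h4 => hq' q h1 h2 h4 h3)
  have hN3 : N % 4 ≠ 3 := mod_four_ne_three_of_eq_sq_add_sq (Nat.eq_sq_add_sq_iff.mpr
    fun q hqm h4 => absurd h4 (hq q (Nat.prime_of_mem_primeFactors hqm)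
      (Nat.dvd_of_mem_primeFactors hqm)))
  obtain ⟨a, ha⟩ := hx
  obtain ⟨b, hb⟩ := hy
  have hmod : A * B % 4 = 2 := by
    have : ((A * B : ℕ) : ℤ) = 4 * (a ^ 2 + b ^ 2 + a + b) + 2 := by
      rw [hprod, ha, hb]; ring
    omega
  rw [Nat.mul_mod] at hmod
  rw [Nat.odd_iff] at hN
  have : A % 4 = 0 ∨ A % 4 = 1 ∨ A % 4 = 2 := by omega
  have : B % 4 = 0 ∨ B % 4 = 1 ∨ B % 4 = 2 := by omega
  rcases ‹A % 4 = 0 ∨ A % 4 = 1 ∨ A % 4 = 2› with h1 | h1 | h1 <;>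
    rcases ‹B % 4 = 0 ∨ B % 4 = 1 ∨ B % 4 = 2› with h2 | h2 | h2 <;>
    rw [h1, h2] at hmod <;> omega

/-- For `N ≡ 3 (mod 4)` three of the squares in `N = a² + b² + c² + d²` are odd, and
`N² = (a² + b² - c² - d²)² + 4 (b c + a d)² + 4 (b d - a c)²` has the required parities. -/
theorem exists_sq_eq_of_three_mod_four {N : ℕ} (hN : N % 4 = 3) :
    ∃ w x y : ℤ, Odd x ∧ Odd y ∧ (N : ℤ) ^ 2 = w ^ 2 + 4 * (x ^ 2 + y ^ 2) := by
  have key : ∀ a b c d : ℤ, Even a → Odd b → Odd c → Odd d →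
      (N : ℤ) = a ^ 2 + b ^ 2 + c ^ 2 + d ^ 2 →
      ∃ w x y : ℤ, Odd x ∧ Odd y ∧ (N : ℤ) ^ 2 = w ^ 2 + 4 * (x ^ 2 + y ^ 2) := by
    intro a b c d ha hb hc hd h
    refine ⟨a ^ 2 + b ^ 2 - c ^ 2 - d ^ 2, b * c + a * d, b * d - a * c,
      (hb.mul hc).add_even (ha.mul_right d), (hb.mul hd).sub_even (ha.mul_right c), ?_⟩
    rw [h]; ring
  obtain ⟨a, b, c, d, h⟩ := Nat.sum_four_squares N
  have h' : (a : ℤ) ^ 2 + b ^ 2 + c ^ 2 + d ^ 2 = N := by exact_mod_cast h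
  generalize (a : ℤ) = a at h'
  generalize (b : ℤ) = b at h'
  generalize (c : ℤ) = c at h'
  generalize (d : ℤ) = d at h'
  have hsq : ∀ t : ℤ, (Even t ∧ t ^ 2 % 4 = 0) ∨ (Odd t ∧ t ^ 2 % 4 = 1) := by
    intro t
    rcases Int.even_or_odd t with ht | ht
    · exact Or.inl ⟨ht, by obtain ⟨s, rfl⟩ := ht; ring_nf; omega⟩
    · exact Or.inr ⟨ht, by obtain ⟨s, rfl⟩ := ht; ring_nf; omega⟩
  rcases hsq a with ⟨ha, ha'⟩ | ⟨ha, ha'⟩ <;> rcases hsq b with ⟨hb, hb'⟩ | ⟨hb, hb'⟩ <;>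
    rcases hsq c with ⟨hc, hc'⟩ | ⟨hc, hc'⟩ <;> rcases hsq d with ⟨hd, hd'⟩ | ⟨hd, hd'⟩ <;>
    first
    | (exfalso; omega)
    | exact key a b c d ha hb hc hd (by linarith)
    | exact key b a c d hb ha hc hd (by linarith)
    | exact key c a b d hc ha hb hd (by linarith)
    | exact key d a b c hd ha hb hc (by linarith)

/-- For `N ≡ 1 (mod 4)` with `N > 1`, write `N = a² + 4 (b² + c² + d²)` with `a ∈ {1, 3}` and
`b² + c² + d² ≡ 1, 2 (mod 4)`, where `c` and `d` can be taken of opposite parity. The square of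
`N` is then a sum of three squares by the same identity as for `N ≡ 3 (mod 4)`. -/
theorem exists_sq_eq_of_one_mod_four {N : ℕ} (hN : N % 4 = 1) (h1 : 1 < N) :
    ∃ w x y : ℤ, Odd x ∧ Odd y ∧ (N : ℤ) ^ 2 = w ^ 2 + 8 * (x ^ 2 + y ^ 2) := by
  have key : ∀ a b c d : ℤ, Odd a → Odd (c + d) →
      (N : ℤ) = a ^ 2 + 4 * (b ^ 2 + c ^ 2 + d ^ 2) →
      ∃ w x y : ℤ, Odd x ∧ Odd y ∧ (N : ℤ) ^ 2 = w ^ 2 + 8 * (x ^ 2 + y ^ 2) := by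
    intro a b c d ha hcd h
    have hx : Odd ((2 * b * c + a * d) + (2 * b * d - a * c)) := by
      have : (2 * b * c + a * d) + (2 * b * d - a * c) = a * (c + d) + 2 * (b * c + b * d - a * c) :=
        by ring
      rw [this]
      exact (ha.mul hcd).add_even (even_two_mul _)
    have hy : Odd ((2 * b * c + a * d) - (2 * b * d - a * c)) := by
      have : (2 * b * c + a * d) - (2 * b * d - a * c) = a * (c + d) + 2 * (b * c - b * d) := by ring
      rw [this]
      exact (ha.mul hcd).add_even (even_two_mul _)
    refine ⟨a ^ 2 + 4 * b ^ 2 - 4 * c ^ 2 - 4 * d ^ 2, _, _, hx, hy, ?_⟩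
    rw [h]; ring
  obtain ⟨a, k, ha, hk0, hk, hak⟩ : ∃ a k : ℤ, Odd a ∧ 0 ≤ k ∧ (k % 4 = 1 ∨ k % 4 = 2) ∧
      (N : ℤ) = a ^ 2 + 4 * k := by
    by_cases hj : ((N : ℤ) - 1) / 4 % 4 = 1 ∨ ((N : ℤ) - 1) / 4 % 4 = 2
    · exact ⟨1, ((N : ℤ) - 1) / 4, odd_one, by omega, hj, by omega⟩
    · exact ⟨3, ((N : ℤ) - 1) / 4 - 2, by decide, by omega, by omega, by omega⟩
  obtain ⟨b, c, d, hbcd⟩ := exists_sum_three_squares k hk0 hk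
  have hpar : Odd (c + d) ∨ Odd (b + d) := by
    by_contra hcon
    push Not at hcon
    rw [Int.not_odd_iff_even, Int.not_odd_iff_even] at hcon
    obtain ⟨⟨s, hs⟩, ⟨t, ht⟩⟩ := hcon
    obtain rfl : c = s + s - d := by linarith
    obtain rfl : b = t + t - d := by linarith
    have : k = 4 * (s ^ 2 + t ^ 2 - s * d - t * d) + 3 * d ^ 2 := by rw [hbcd]; ring
    rcases Int.even_or_odd' d with ⟨e, rfl | rfl⟩ <;> ring_nf at this <;> omega
  rcases hpar with h | h
  · exact key a b c d ha h (by rw [hak, hbcd])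
  · exact key a c b d ha h (by rw [hak, hbcd]; ring)

theorem exists_sq_eq_of_dvd {m : ℕ} {d : ℕ} {c : ℤ} (hd : d ∣ 2 * m + 1)
    (h : ∃ w x y : ℤ, Odd x ∧ Odd y ∧ (d : ℤ) ^ 2 = w ^ 2 + c * (x ^ 2 + y ^ 2)) :
    ∃ w x y : ℤ, Odd x ∧ Odd y ∧ (2 * m + 1 : ℤ) ^ 2 = w ^ 2 + c * (x ^ 2 + y ^ 2) := by
  obtain ⟨e, he⟩ := hd
  obtain ⟨w, x, y, hx, hy, h⟩ := h
  have heo : Odd (e : ℤ) := by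
    have : Odd (d * e) := he ▸ odd_two_mul_add_one m
    exact_mod_cast (Nat.odd_mul.mp this).2
  refine ⟨e * w, e * x, e * y, heo.mul hx, heo.mul hy, ?_⟩
  have : (2 * m + 1 : ℤ) = d * e := by exact_mod_cast he
  rw [this]
  linear_combination (e : ℤ) ^ 2 * h

/-! ### Return to triangular numbers -/

theorem exists_sq_add_sq_add_triangular_of_sq_eq {m : ℤ} {w x y : ℤ}
    (h : (2 * m + 1) ^ 2 = w ^ 2 + 8 * (x ^ 2 + y ^ 2)) :
    ∃ z : ℤ, triangular m = x ^ 2 + y ^ 2 + triangular z := by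
  have hm := two_mul_triangular m
  rcases Int.even_or_odd' w with ⟨z, rfl | rfl⟩
  · exfalso; ring_nf at h; omega
  · exact ⟨z, eight_mul_add_one_eq.mpr (by linear_combination 4 * hm + h)⟩

theorem exists_two_odd_sq_add_triangular_iff {m : ℕ} (hm : 0 < m) :
    (∃ x y z : ℤ, Odd x ∧ Odd y ∧ triangular m = x ^ 2 + y ^ 2 + triangular z) ↔
      ¬ ((2 * m + 1).Prime ∧ 2 * m + 1 ≡ 3 [MOD 4]) := by
  constructor
  · rintro ⟨x, y, z, hx, hy, h⟩ ⟨hp, h4⟩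
    have hm := two_mul_triangular m
    refine not_sq_eq_of_prime hp h4 (w := 2 * z + 1) hx hy ?_
    have := eight_mul_add_one_eq.mp h
    push_cast
    linarith
  · intro hp
    -- Unless `2 m + 1` is a prime `≡ 3 (mod 4)`, it has a divisor `d > 1` with `d ≡ 1 (mod 4)`.
    obtain ⟨d, hd, hd4, hd1⟩ : ∃ d, d ∣ 2 * m + 1 ∧ d % 4 = 1 ∧ 1 < d := by
      rcases (show (2 * m + 1) % 4 = 1 ∨ (2 * m + 1) % 4 = 3 by omega) with h | h
      · exact ⟨_, dvd_rfl, h, by omega⟩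
      have hnp : ¬ (2 * m + 1).Prime := fun h' => hp ⟨h', h⟩
      obtain ⟨a, b, ha, hb, hab⟩ := (Nat.not_prime_iff_exists_mul_eq (by omega)).mp hnp
      have ha1 : 1 < a := by by_contra hc; interval_cases a <;> omega
      have hb1 : 1 < b := by by_contra hc; interval_cases b <;> omega
      have hmul : (a % 4) * (b % 4) % 4 = 3 := by rw [← Nat.mul_mod, hab, h]
      have hlt := Nat.mod_lt a (show 4 > 0 by norm_num)
      have hlt' := Nat.mod_lt b (show 4 > 0 by norm_num)
      rcases (show a % 4 = 1 ∨ b % 4 = 1 by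
        generalize a % 4 = r at *; generalize b % 4 = s at *
        interval_cases r <;> interval_cases s <;> omega) with h4 | h4
      · exact ⟨a, ⟨b, hab.symm⟩, h4, ha1⟩
      · exact ⟨b, ⟨a, by rw [← hab, mul_comm]⟩, h4, hb1⟩
    obtain ⟨w, x, y, hx, hy, h⟩ := exists_sq_eq_of_dvd hd (exists_sq_eq_of_one_mod_four hd4 hd1)
    obtain ⟨z, hz⟩ := exists_sq_add_sq_add_triangular_of_sq_eq h
    exact ⟨x, y, z, hx, hy, hz⟩

theorem exists_odd_add_of_prime_dvd {m p : ℕ} (h4 : p % 4 = 3) (hp : p ∣ 2 * m + 1) :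
    ∃ x y z : ℤ, Odd (x + y) ∧ triangular m = x ^ 2 + y ^ 2 + triangular z := by
  obtain ⟨w, x, y, hx, hy, h⟩ := exists_sq_eq_of_dvd hp (exists_sq_eq_of_three_mod_four h4)
  obtain ⟨s, hs⟩ := hx.add_odd hy
  obtain rfl : y = s + s - x := by linarith
  obtain ⟨z, hz⟩ := exists_sq_add_sq_add_triangular_of_sq_eq
    (show (2 * (m : ℤ) + 1) ^ 2 = w ^ 2 + 8 * (s ^ 2 + (x - s) ^ 2) by rw [h]; ring)
  exact ⟨s, x - s, z, by simpa using hx, hz⟩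

theorem exists_nat_triangular_eq (x : ℤ) : ∃ m : ℕ, triangular x = triangular m := by
  rcases le_or_gt 0 x with h | h
  · exact ⟨x.toNat, by rw [Int.toNat_of_nonneg h]⟩
  · exact ⟨(-1 - x).toNat, by rw [Int.toNat_of_nonneg (by omega), triangular_neg_one_sub]⟩

/-- The dichotomy used for both parts: a positive `k` is `x² + y² + T_z` with `x + y` odd, unless
`k = T_m` where no prime `≡ 3 (mod 4)` divides `2 m + 1`. -/
theorem exists_odd_add_or_eq_triangular {k : ℤ} (hk : 0 < k) :
    (∃ x y z : ℤ, Odd (x + y) ∧ k = x ^ 2 + y ^ 2 + triangular z) ∨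
      ∃ m : ℕ, 0 < m ∧ k = triangular m ∧
        ∀ p : ℕ, p.Prime → p ∣ 2 * m + 1 → ¬ p ≡ 3 [MOD 4] := by
  by_cases hT : ∀ m, k ≠ triangular m
  · obtain ⟨x, y, z, h⟩ := exists_sq_add_sq_add_triangular hk.le
    exact Or.inl (exists_odd_add_of_ne_triangular hT h)
  push Not at hT
  obtain ⟨x, hx⟩ := hT
  obtain ⟨m, hm⟩ := exists_nat_triangular_eq x
  have hkm := hx.trans hm
  by_cases hp : ∃ p : ℕ, p.Prime ∧ p ∣ 2 * m + 1 ∧ p ≡ 3 [MOD 4]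
  · obtain ⟨p, -, hpd, hp4⟩ := hp
    exact Or.inl (hkm ▸ exists_odd_add_of_prime_dvd hp4 hpd)
  · push Not at hp
    refine Or.inr ⟨m, Nat.pos_of_ne_zero ?_, hkm, hp⟩
    rintro rfl
    rw [hkm] at hk
    exact absurd hk (by decide)

theorem exists_sq_add_odd_sq_add_triangular {n : ℤ} (hn : 0 < n) :
    ∃ x y z : ℤ, Odd y ∧ n = x ^ 2 + y ^ 2 + triangular z := by
  rcases exists_odd_add_or_eq_triangular hn with ⟨x, y, z, hxy, h⟩ | ⟨m, hm, h, hp⟩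
  · rcases Int.even_or_odd y with hy | hy
    · exact ⟨y, x, z, by rw [Int.odd_add] at hxy; exact hxy.mpr hy, by rw [h]; ring⟩
    · exact ⟨x, y, z, hy, h⟩
  · obtain ⟨x, y, z, -, hy, hz⟩ := (exists_two_odd_sq_add_triangular_iff hm).mpr
      fun ⟨h1, h2⟩ => hp _ h1 dvd_rfl h2
    exact ⟨x, y, z, hy, h.trans hz⟩

theorem triangular_add_triangular (j t : ℤ) :
    triangular (j + t) + triangular (j - t) = 2 * triangular j + t ^ 2 := by
  have h1 := two_mul_triangular (j + t)
  have h2 := two_mul_triangular (j - t)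
  have h3 := two_mul_triangular j
  linarith

/-- A number `x² + t² + 2 T_j` with `x` odd is an odd square plus two triangular numbers. -/
theorem exists_odd_sq_add_two_triangular_of_eq {n x t j : ℤ} (hx : Odd x)
    (h : n = x ^ 2 + t ^ 2 + 2 * triangular j) :
    ∃ x y z : ℤ, Odd x ∧ n = x ^ 2 + triangular y + triangular z :=
  ⟨x, j + t, j - t, hx, by linarith [triangular_add_triangular j t]⟩

theorem exists_odd_sq_add_two_triangular_of_odd {n : ℤ} (hn : 0 < n) (ho : Odd n) :
    ∃ x y z : ℤ, Odd x ∧ n = x ^ 2 + triangular y + triangular z := by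
  obtain ⟨u, v, w, h⟩ := exists_sum_three_squares (4 * n + 1) (by omega) (by omega)
  have key : ∀ j a b : ℤ, 4 * n + 1 = (2 * j + 1) ^ 2 + (2 * a) ^ 2 + (2 * b) ^ 2 →
      ∃ x y z : ℤ, Odd x ∧ n = x ^ 2 + triangular y + triangular z := by
    intro j a b h
    have hj := two_mul_triangular j
    have hn' : n = a ^ 2 + b ^ 2 + 2 * triangular j := by linarith
    rcases Int.even_or_odd a with ha | ha
    · have hb : Odd b := by
        by_contra hb
        rw [Int.not_odd_iff_even] at hb
        exact Int.not_even_iff_odd.mpr ho (hn' ▸ ((ha.pow_of_ne_zero two_ne_zero).add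
          (hb.pow_of_ne_zero two_ne_zero)).add (even_two_mul _))
      exact exists_odd_sq_add_two_triangular_of_eq (t := a) (j := j) hb (by rw [hn']; ring)
    · exact exists_odd_sq_add_two_triangular_of_eq ha hn'
  obtain ⟨a, rfl | rfl⟩ := Int.even_or_odd' u <;> obtain ⟨b, rfl | rfl⟩ := Int.even_or_odd' v <;>
    obtain ⟨c, rfl | rfl⟩ := Int.even_or_odd' w <;>
    first
    | exact key a b c (by linarith)
    | exact key b a c (by linarith)
    | exact key c a b (by linarith)
    | (exfalso; ring_nf at h; omega)

/-- Here `4 n + 1 = (2 m + 1)²`, and a representation of `n` as an odd square plus two triangular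
numbers gives `(2 m + 1)² = w² + 4 x² + 4 y²` with `x` and `y` odd. -/
theorem not_eq_odd_sq_add_two_triangular {m : ℕ}
    (hp : ∀ p : ℕ, p.Prime → p ∣ 2 * m + 1 → ¬ p ≡ 3 [MOD 4]) {x y z : ℤ} (hx : Odd x)
    (h : 2 * triangular m = x ^ 2 + triangular y + triangular z) : False := by
  have hm := two_mul_triangular m
  have hy := two_mul_triangular y
  have hz := two_mul_triangular z
  have key : ∀ w t : ℤ, (2 * m + 1 : ℤ) ^ 2 = w ^ 2 + 4 * (x ^ 2 + t ^ 2) → Odd t → False :=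
    fun w t h ht => not_sq_eq_of_forall_prime (N := 2 * m + 1) (odd_two_mul_add_one m)
      (fun q hq hd h4 => hp q hq hd h4) hx ht (by push_cast; exact h)
  -- One of `y + z + 1` and `y - z` is odd and the other is twice an odd number `t`.
  rcases Int.even_or_odd' (y - z) with ⟨t, ht | ht⟩
  · obtain rfl : y = z + 2 * t := by linarith
    have h' := triangular_add_triangular (z + t) t
    rw [add_sub_cancel_right, show z + t + t = z + 2 * t by ring] at h'
    have hj := two_mul_triangular (z + t)
    refine key (2 * (z + t) + 1) t (by linarith) ?_
    have : Even (x ^ 2 + t ^ 2) := ⟨triangular m - triangular (z + t), by linarith⟩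
    rw [Int.even_add', Int.odd_pow' two_ne_zero, Int.odd_pow' two_ne_zero] at this
    exact this.mp hx
  · -- The substitution `z ↦ -1 - z` exchanges `y + z + 1` and `y - z`.
    obtain rfl : y = z + 2 * t + 1 := by linarith
    have h' := triangular_add_triangular t (z + t + 1)
    rw [show t - (z + t + 1) = -1 - z by ring, triangular_neg_one_sub,
      show t + (z + t + 1) = z + 2 * t + 1 by ring] at h'
    have hj := two_mul_triangular t
    refine key (2 * t + 1) (z + t + 1) (by linarith) ?_
    have : Even (x ^ 2 + (z + t + 1) ^ 2) := ⟨triangular m - triangular t, by linarith⟩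
    rw [Int.even_add', Int.odd_pow' two_ne_zero, Int.odd_pow' two_ne_zero] at this
    exact this.mp hx

theorem not_exists_odd_sq_add_two_triangular_iff {n : ℤ} (hn : 0 < n) :
    (¬ ∃ x y z : ℤ, Odd x ∧ n = x ^ 2 + triangular y + triangular z) ↔
      ∃ m : ℕ, 0 < m ∧ n = 2 * triangular (m : ℤ) ∧
        ∀ p : ℕ, p.Prime → p ∣ 2 * m + 1 → ¬ p ≡ 3 [MOD 4] := by
  constructor
  · intro hno
    rcases Int.even_or_odd' n with ⟨k, rfl | hk⟩
    · rcases exists_odd_add_or_eq_triangular (show 0 < k by omega) with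
        ⟨a, b, j, hab, h⟩ | ⟨m, hm, h, hp⟩
      · exact absurd (exists_odd_sq_add_two_triangular_of_eq (t := a - b) (j := j) hab
          (by rw [h]; ring)) hno
      · exact ⟨m, hm, by rw [h], hp⟩
    · exact absurd (exists_odd_sq_add_two_triangular_of_odd hn ⟨k, hk⟩) hno
  · rintro ⟨m, -, rfl, hp⟩ ⟨x, y, z, hx, h⟩
    exact not_eq_odd_sq_add_two_triangular hp hx h

theorem theorem1p1 :
    ((∀ n : ℤ, 0 < n → ∃ x y z : ℤ, Odd y ∧ n = x ^ 2 + y ^ 2 + triangular z) ∧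
      (∀ m : ℕ, 0 < m →
        ((∃ x y z : ℤ, Odd x ∧ Odd y ∧ triangular (m : ℤ) = x ^ 2 + y ^ 2 + triangular z) ↔
          ¬ (Nat.Prime (2 * m + 1) ∧ 2 * m + 1 ≡ 3 [MOD 4])))) ∧
    (∀ n : ℤ, 0 < n →
      ((¬ ∃ x y z : ℤ, Odd x ∧ n = x ^ 2 + triangular y + triangular z) ↔
        ∃ m : ℕ, 0 < m ∧ n = 2 * triangular (m : ℤ) ∧
          ∀ p : ℕ, p.Prime → p ∣ 2 * m + 1 → ¬ p ≡ 3 [MOD 4])) :=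
  ⟨⟨fun _ hn => exists_sq_add_odd_sq_add_triangular hn,
      fun _ hm => exists_two_odd_sq_add_triangular_iff hm⟩,
    fun _ hn => not_exists_odd_sq_add_two_triangular_iff hn⟩
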